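/- Let $A,B,A',B',\hat A,\hat B$ be finite-dimensional quantum systems ($A$ and $B$ nonzero), each with a fixed orthonormal basis, let $\mathcal N_{AB\to A'B'}$ be a quantum channel (a completely positive trace-preserving linear map) and let $\rho_{\hat A\hat B}$ be a quantum state (positive semi-definite, trace one). Transposes $T$ are taken in the fixed bases. A channel $\mathcal P_{A\hat AB\hat B\to A'B'}$, in which Alice holds $A,\hat A,A'$ and Bob holds $B,\hat B,B'$, is called C-PPT-P if $T_{B'}\circ\mathcal P\circ T_{B\hat B}$ is completely positive. The fidelity of states is $F(\omega,\tau)=\|\sqrt\omega\sqrt\tau\|_1^2$, and the fidelity of channels is $F(\mathcal N,\mathcal M)=\inf_{\rho_{RC}}F\big((\mathrm{id}_R\otimes\mathcal N)(\rho_{RC}),(\mathrm{id}_R\otimes\mathcal M)(\rho_{RC})\big)$, where the infimum is over all states $\rho_{RC}$ of the input system $C$ and a reference system $R$ of arbitrary finite dimension. Define the simulation error $$e^F_{\mathrm{PPT}}(\mathcal N,\rho_{\hat A\hat B})=\inf_{\mathcal P\in\text{C-PPT-P}}\big(1-F(\mathcal N,\widetilde{\mathcal N})\big),\qquad \widetilde{\mathcal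 N}(\omega_{AB})=\mathcal P(\omega_{AB}\otimes\rho_{\hat A\hat B}).$$ Let $\Gamma^{\mathcal N}_{ABA'B'}=(\mathrm{id}\otimes\mathcal N)(|\Gamma\rangle\!\langle\Gamma|)$, with $|\Gamma\rangle=\sum_i|i\rangle|i\rangle$, be the Choi operator of $\mathcal N$, and write $\operatorname{Re}[X]=\tfrac12(X+X^\dagger)$. Then $$e^F_{\mathrm{PPT}}(\mathcal N,\rho_{\hat A\hat B})=1-\Big[\sup_{\lambda\ge 0,\;P_{AB\hat A\hat BA'B'}\ge 0,\;Q_{ABA'B'}}\lambda\Big]^2,$$ where $\lambda$ is real, $P$ and $Q$ are linear operators on the indicated systems, and the supremum is subject to $$\lambda I_{AB}\le\operatorname{Re}\big[\operatorname{Tr}_{A'B'}[Q_{ABA'B'}]\big],\qquad T_{B\hat BB'}(P_{AB\hat A\hat BA'B'})\ge0,\qquad \operatorname{Tr}_{A'B'}[P_{AB\hat A\hat BA'B'}]=I_{AB\hat A\hat B},$$ $$\begin{bmatrix}\Gamma^{\mathcal N}_{ABA'B'}&Q^\dagger_{ABA'B'}\\ Q_{ABA'B'}&\operatorname{Tr}_{\hat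 A\hat B}[T_{\hat A\hat B}(\rho_{\hat A\hat B})P_{AB\hat A\hat BA'B'}]\end{bmatrix}\ge0 .$$ Moreover, the constraints are feasible and the feasible values of $\lambda$ are bounded above, so that the supremum is a real number. -/

import Mathlib

open scoped MatrixOrder ComplexOrder ComplexStarModule Kronecker

noncomputable section

namespace BipartiteSim

/-- A finite-dimensional quantum system is given by the finite type indexing its orthonormal basis;
operators on it are complex matrices, and composite systems are indexed by product types. -/
abbrev Op (c : Type*) : Type _ := Matrix c c ℂ

/-- Quantum states (density operators): positive semi-definite with trace one. -/
structure IsState {c : Type*} [Fintype c] (ρ : Op c) : Prop where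
  posSemidef : ρ.PosSemidef
  trace_eq_one : ρ.trace = 1

/-- The trace norm `‖X‖₁ = Tr |X|`, where `|X| = √(X† X)`. -/
def traceNorm {c : Type*} [Fintype c] [DecidableEq c] (X : Op c) : ℝ :=
  (CFC.sqrt (X.conjTranspose * X)).trace.re

/-- The fidelity `F(ω, τ) = ‖√ω √τ‖₁²`. -/
def fidelity {c : Type*} [Fintype c] [DecidableEq c] (ω τ : Op c) : ℝ :=
  traceNorm (CFC.sqrt ω * CFC.sqrt τ) ^ 2

/-- The action of `id_R ⊗ Φ` on operators of the composite system `RC`: the map `Φ` is applied to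
every block `⟨i|_R X |j⟩_R`. -/
def idTensor (r : Type*) {c d : Type*} (Φ : Op c →ₗ[ℂ] Op d) (X : Op (r × c)) : Op (r × d) :=
  Matrix.of fun x y => Φ (Matrix.of fun i j => X (x.1, i) (y.1, j)) x.2 y.2

/-- Complete positivity: `id_R ⊗ Φ` preserves positive semi-definiteness for every
finite-dimensional reference system `R`. -/
def IsCompletelyPositive {c d : Type*} [Fintype c] [Fintype d] (Φ : Op c →ₗ[ℂ] Op d) : Prop :=
  ∀ (k : ℕ) (X : Op (Fin k × c)), X.PosSemidef → (idTensor (Fin k) Φ X).PosSemidef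

/-- Quantum channels: completely positive trace-preserving linear maps. -/
structure IsChannel {c d : Type*} [Fintype c] [Fintype d] (Φ : Op c →ₗ[ℂ] Op d) : Prop where
  completelyPositive : IsCompletelyPositive Φ
  tracePreserving : ∀ X : Op c, (Φ X).trace = X.trace

/-- The channel fidelity `F(N, M) = inf_{ρ_{RC}} F(N(ρ_{RC}), M(ρ_{RC}))`, the infimum being over
all states `ρ_{RC}` with a reference system `R` of arbitrary finite dimension. -/
def channelFidelity {c d : Type*} [Fintype c] [Fintype d] [DecidableEq d]
    (N M : Op c →ₗ[ℂ] Op d) : ℝ :=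
  sInf {f : ℝ | ∃ (k : ℕ) (ρ : Op (Fin k × c)), IsState ρ ∧
    f = fidelity (idTensor (Fin k) N ρ) (idTensor (Fin k) M ρ)}

/-- The unnormalized maximally entangled vector `|Γ⟩_{RC} = ∑ i, |i⟩_R |i⟩_C`. -/
def maxEntVec (c : Type*) [DecidableEq c] : c × c → ℂ := fun x => if x.1 = x.2 then 1 else 0

/-- The operator `Γ_{RC} = |Γ⟩⟨Γ|_{RC}`. -/
def maxEnt (c : Type*) [DecidableEq c] : Op (c × c) :=
  Matrix.vecMulVec (maxEntVec c) (star (maxEntVec c))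

/-- The Choi operator `Γ_{RD}^N = (id_R ⊗ N)(Γ_{RC})`. -/
def choi {c d : Type*} [DecidableEq c] (N : Op c →ₗ[ℂ] Op d) : Op (c × d) :=
  idTensor c N (maxEnt c)

/-- The partial trace over the first tensor factor. -/
def traceFst {c d : Type*} [Fintype c] (X : Op (c × d)) : Op d :=
  Matrix.of fun i j => ∑ k, X (k, i) (k, j)

/-- The partial trace over the second tensor factor. -/
def traceSnd {c d : Type*} [Fintype d] (X : Op (c × d)) : Op c :=
  Matrix.of fun i j => ∑ k, X (i, k) (j, k)

/-- The partial transpose `id ⊗ T` on the second tensor factor. -/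
def transposeSnd (c d : Type*) : Op (c × d) →ₗ[ℂ] Op (c × d) where
  toFun X := Matrix.of fun x y => X (x.1, y.2) (y.1, x.2)
  map_add' _ _ := rfl
  map_smul' _ _ := rfl

/-- Relabelling of four systems `(12)(34)` as `(13)(24)`. -/
def regroup {c₁ c₂ c₃ c₄ : Type*} (X : Op ((c₁ × c₂) × (c₃ × c₄))) :
    Op ((c₁ × c₃) × (c₂ × c₄)) :=
  Matrix.reindex (Equiv.prodProdProdComm c₁ c₂ c₃ c₄) (Equiv.prodProdProdComm c₁ c₂ c₃ c₄) X

/-- A bipartite map `P_{AB → A'B'}` is a C-PPT-P channel if it is a quantum channel and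
`T_{B'} ∘ P ∘ T_B` is completely positive. -/
structure IsCPPTP {a b a' b' : Type*} [Fintype a] [Fintype b] [Fintype a'] [Fintype b']
    (P : Op (a × b) →ₗ[ℂ] Op (a' × b')) : Prop where
  channel : IsChannel P
  ppt : IsCompletelyPositive (transposeSnd a' b' ∘ₗ P ∘ₗ transposeSnd a b)

/-- The simulation `ω_{AB} ↦ P(ω_{AB} ⊗ ρ_{ÂB̂})`. The bipartite map `P` has Alice's input `AÂ` and
Bob's input `BB̂`. -/
def simulate {a b ah bh a' b' : Type*} (ρ : Op (ah × bh))
    (P : Op ((a × ah) × (b × bh)) →ₗ[ℂ] Op (a' × b')) : Op (a × b) →ₗ[ℂ] Op (a' × b') where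
  toFun ω := P (regroup (ω ⊗ₖ ρ))
  map_add' ω₁ ω₂ := by rw [Matrix.add_kronecker, ← map_add]; rfl
  map_smul' z ω := by rw [Matrix.smul_kronecker, RingHom.id_apply, ← map_smul]; rfl

/-- The simulation error of `N` with resource state `ρ`, minimized over all C-PPT-P channels and
measured by the channel infidelity. -/
def errPPT {a b ah bh a' b' : Type*} [Fintype a] [Fintype b] [Fintype ah] [Fintype bh]
    [Fintype a'] [Fintype b'] [DecidableEq a'] [DecidableEq b']
    (N : Op (a × b) →ₗ[ℂ] Op (a' × b')) (ρ : Op (ah × bh)) : ℝ :=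
  sInf {e : ℝ | ∃ P : Op ((a × ah) × (b × bh)) →ₗ[ℂ] Op (a' × b'), IsCPPTP P ∧
    e = 1 - channelFidelity N (simulate ρ P)}

/-- The relabelling of the systems `(AÂ)(BB̂)(A'B')` as `(ÂB̂)((AB)(A'B'))`. -/
def resourceFirst (a b ah bh a' b' : Type*) :
    ((a × ah) × (b × bh)) × (a' × b') ≃ (ah × bh) × ((a × b) × (a' × b')) where
  toFun x := ((x.1.1.2, x.1.2.2), ((x.1.1.1, x.1.2.1), x.2))
  invFun y := (((y.2.1.1, y.1.1), (y.2.1.2, y.1.2)), y.2.2)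
  left_inv _ := rfl
  right_inv _ := rfl

/-- The operator `Tr_{ÂB̂}[T_{ÂB̂}(ρ_{ÂB̂}) P_{ABÂB̂A'B'}]` on `ABA'B'`. -/
def contractResource {a b ah bh a' b' : Type*} [Fintype a] [Fintype b] [Fintype ah] [Fintype bh]
    [Fintype a'] [Fintype b'] [DecidableEq a] [DecidableEq b] [DecidableEq a'] [DecidableEq b']
    (ρ : Op (ah × bh)) (P : Op (((a × ah) × (b × bh)) × (a' × b'))) :
    Op ((a × b) × (a' × b')) :=
  traceFst ((ρ.transpose ⊗ₖ (1 : Op ((a × b) × (a' × b')))) *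
    Matrix.reindex (resourceFirst a b ah bh a' b') (resourceFirst a b ah bh a' b') P)

/-- The constraints of the semi-definite program on the variables `lam`, `P` and `Q`. Inequalities
between operators refer to the Loewner order, and `ℜ X = (X + X†) / 2`. -/
structure IsFeasible {a b ah bh a' b' : Type*} [Fintype a] [Fintype b] [Fintype ah] [Fintype bh]
    [Fintype a'] [Fintype b'] [DecidableEq a] [DecidableEq b] [DecidableEq ah] [DecidableEq bh]
    [DecidableEq a'] [DecidableEq b']
    (N : Op (a × b) →ₗ[ℂ] Op (a' × b')) (ρ : Op (ah × bh)) (lam : ℝ)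
    (P : Op (((a × ah) × (b × bh)) × (a' × b'))) (Q : Op ((a × b) × (a' × b'))) : Prop where
  lam_nonneg : 0 ≤ lam
  posSemidef : P.PosSemidef
  lam_le : (lam : ℂ) • (1 : Op (a × b)) ≤ (ℜ (traceSnd Q) : Op (a × b))
  /-- `T_{BB̂B'}(P) ≥ 0`, with the systems of Alice and those of Bob grouped together. -/
  ppt : (transposeSnd ((a × ah) × a') ((b × bh) × b') (regroup P)).PosSemidef
  tracePreserving : traceSnd P = 1
  block : (Matrix.fromBlocks (choi N) Q.conjTranspose Q (contractResource ρ P)).PosSemidef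

/-- The set of objective values `lam` attained at feasible points of the semi-definite program. -/
def feasibleValues {a b ah bh a' b' : Type*} [Fintype a] [Fintype b] [Fintype ah] [Fintype bh]
    [Fintype a'] [Fintype b'] [DecidableEq a] [DecidableEq b] [DecidableEq ah] [DecidableEq bh]
    [DecidableEq a'] [DecidableEq b']
    (N : Op (a × b) →ₗ[ℂ] Op (a' × b')) (ρ : Op (ah × bh)) : Set ℝ :=
  {lam : ℝ | ∃ (P : Op (((a × ah) × (b × bh)) × (a' × b'))) (Q : Op ((a × b) × (a' × b'))),
    IsFeasible N ρ lam P Q}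

end BipartiteSim

end

namespace BipartiteSim
open Matrix

/-! ### Root fidelity as an optimum over positive block matrices -/

section MatrixLemmas

variable {l m n : Type*} [Fintype l] [Fintype m] [Fintype n]

/-! The Choi isomorphism turns C-PPT-P channels into exactly the operators `P` of the program
(`isCPPTP_iff`), and contracting such a `P` with the resource gives the Choi operator of the
simulation (`choi_simulate`). By `mem_feasibleValues_iff` it then remains to show, for fixed
channels `N` and `M`, that the root channel fidelity is the supremum of the `lam ≥ 0` for which some
`Q` satisfies the block constraint and the bound on its marginal.

For states, the root fidelity is the maximum of `Re Tr X` over positive blocks with diagonal `ω, τ`: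
this follows from the polar decomposition. If `Q` is feasible for the Choi operators, contracting
the block with any input state gives such an `X`, with trace at least `lam` in real part; hence
`lam` is at most the root channel fidelity (`le_traceNorm_of_block`).

Conversely, a pure input whose marginal corresponds to a positive definite `σ` acts on Choi
operators by an invertible congruence, so an optimal `X` pulls back to a `Q` adapted to that `σ`
(`exists_block_of_posDef`). The choice of `Q` must however serve all `σ` at once. This exchange of
quantifiers is a minimax argument: the marginals of admissible `Q` form a convex set, and if none
has real part above `f`, Hahn–Banach separation yields a state `σ` that is bad for all of them.
Mixing `σ` slightly with the maximally mixed state makes it positive definite and contradicts the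
previous step whenever `f` is strictly below the root fidelity (`exists_block_le_realPart`). Values
strictly below suffice for a supremum, so attainment is never needed. -/

theorem exists_eq_conjTranspose_mul_self {A : Matrix n n ℂ} (hA : A.PosSemidef) :
    ∃ C : Matrix n n ℂ, A = Cᴴ * C := by
  classical
  refine ⟨CFC.sqrt A, ?_⟩
  have h := (nonneg_iff_posSemidef.1 (CFC.sqrt_nonneg A)).isHermitian
  rw [h.eq, CFC.sqrt_mul_sqrt_self A (nonneg_iff_posSemidef.2 hA)]

theorem trace_mul_nonneg {P A : Matrix n n ℂ} (hP : P.PosSemidef) (hA : A.PosSemidef) :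
    0 ≤ (P * A).trace := by
  obtain ⟨C, rfl⟩ := exists_eq_conjTranspose_mul_self hA
  rw [← Matrix.mul_assoc, Matrix.trace_mul_comm, ← Matrix.mul_assoc]
  exact (hP.mul_mul_conjTranspose_same C).trace_nonneg

/-- A pseudo-inverse of a positive semi-definite matrix. -/
theorem exists_pseudoinverse [DecidableEq n] {A : Matrix n n ℂ} (hA : A.PosSemidef) :
    ∃ G : Matrix n n ℂ, Gᴴ = G ∧ A * G = G * A ∧ G * A * A = A := by
  have hsa : IsSelfAdjoint A := hA.isHermitian
  have hfin : (spectrum ℝ A).Finite := A.finite_real_spectrum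
  -- Every function is continuous on a finite spectrum, so `x⁻¹` may be applied; the convention `0⁻¹
  -- = 0` makes it the inverse on the range and zero on the kernel.
  have hcont : ContinuousOn (fun x : ℝ => x⁻¹) (spectrum ℝ A) := hfin.continuousOn _
  have hid : cfc (fun x : ℝ => x) A = A := cfc_id' ℝ A
  refine ⟨cfc (fun x : ℝ => x⁻¹) A, ?_, ?_, ?_⟩
  · exact cfc_predicate (fun x : ℝ => x⁻¹) A
  · have h := (cfc_commute_cfc (fun x : ℝ => x) (fun x : ℝ => x⁻¹) A).eq
    rwa [hid] at h
  · have h1 : cfc (fun x : ℝ => x⁻¹ * x * x) A = cfc (fun x : ℝ => x⁻¹) A * A * A := by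
      rw [cfc_mul (fun x : ℝ => x⁻¹ * x) (fun x : ℝ => x) A (hfin.continuousOn _)
        (hfin.continuousOn _), cfc_mul (fun x : ℝ => x⁻¹) (fun x : ℝ => x) A hcont
        (hfin.continuousOn _), hid]
    rw [← h1]
    have h2 : (fun x : ℝ => x⁻¹ * x * x) = fun x => x := by
      funext x
      by_cases hx : x = 0
      · simp [hx]
      · field_simp
    rw [h2, hid]

/-- The polar decomposition. -/
theorem exists_polar [DecidableEq n] {A : Matrix n n ℂ} (hA : A.PosSemidef) {B : Matrix m n ℂ}
    (h : Bᴴ * B = A * A) :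
    ∃ V : Matrix m n ℂ, V * A = B ∧ (1 - Vᴴ * V).PosSemidef ∧ Vᴴ * B = A := by
  obtain ⟨G, hG, hc, hGA⟩ := exists_pseudoinverse hA
  have hAh : Aᴴ = A := hA.isHermitian
  have hAGA : A * G * A = A := by rw [hc, hGA]
  -- With `G` the pseudo-inverse of `A`, the Gram relation makes `B * G` a partial isometry whose
  -- initial projection is `A * G`.
  refine ⟨B * G, ?_, ?_, ?_⟩
  · rw [← sub_eq_zero, ← conjTranspose_mul_self_eq_zero]
    have : B * G * A - B = B * (G * A - 1) := by
      rw [Matrix.mul_sub, Matrix.mul_one, Matrix.mul_assoc]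
    rw [this, conjTranspose_mul, Matrix.mul_assoc, ← Matrix.mul_assoc Bᴴ, h, Matrix.mul_assoc A A,
      Matrix.mul_sub A (G * A), ← Matrix.mul_assoc A G, hAGA, Matrix.mul_one, sub_self,
      Matrix.mul_zero, Matrix.mul_zero]
  · have h1 : (B * G)ᴴ * (B * G) = A * G := by
      rw [conjTranspose_mul, hG, Matrix.mul_assoc, ← Matrix.mul_assoc Bᴴ, h,
        ← Matrix.mul_assoc, ← Matrix.mul_assoc, hGA]
    have h2 : (1 : Matrix n n ℂ) - A * G = (1 - A * G)ᴴ * (1 - A * G) := by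
      rw [conjTranspose_sub, conjTranspose_mul, hG, hAh, conjTranspose_one, ← hc]
      have : A * G * (A * G) = A * G := by rw [← Matrix.mul_assoc, hAGA]
      rw [Matrix.mul_sub, Matrix.sub_mul, Matrix.sub_mul, this]
      simp
    rw [h1, h2]
    exact posSemidef_conjTranspose_mul_self _
  · rw [conjTranspose_mul, hG, Matrix.mul_assoc, h, ← Matrix.mul_assoc, hGA]

theorem contraction_conjTranspose [DecidableEq m] [DecidableEq n] {V : Matrix m n ℂ}
    (h : (1 - Vᴴ * V).PosSemidef) : (1 - Vᴴᴴ * Vᴴ).PosSemidef := by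
  have : 1 - Vᴴᴴ * Vᴴ = (1 - V * Vᴴ)ᴴ * (1 - V * Vᴴ) + V * (1 - Vᴴ * V) * Vᴴ := by
    simp only [conjTranspose_sub, conjTranspose_mul, conjTranspose_one, conjTranspose_conjTranspose,
      Matrix.mul_sub, Matrix.sub_mul, Matrix.mul_one, Matrix.one_mul, Matrix.mul_assoc]
    abel
  rw [this]
  exact (posSemidef_conjTranspose_mul_self _).add (h.mul_mul_conjTranspose_same V)

theorem contraction_mul [DecidableEq m] [DecidableEq n] {W : Matrix l m ℂ} {V : Matrix m n ℂ}
    (hW : (1 - Wᴴ * W).PosSemidef) (hV : (1 - Vᴴ * V).PosSemidef) :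
    (1 - (W * V)ᴴ * (W * V)).PosSemidef := by
  have : 1 - (W * V)ᴴ * (W * V) = (1 - Vᴴ * V) + Vᴴ * (1 - Wᴴ * W) * V := by
    simp only [conjTranspose_mul, Matrix.mul_sub, Matrix.sub_mul, Matrix.mul_one,
      Matrix.mul_assoc]
    abel
  rw [this]
  exact hV.add (hW.conjTranspose_mul_mul_same V)

/-- The operator `2 - K - K†` is positive, being `(1 - K†K) + (K - 1)†(K - 1)`; pair it with `A`. -/
theorem re_trace_contraction_mul_le [DecidableEq n] {K A : Matrix n n ℂ}
    (hK : (1 - Kᴴ * K).PosSemidef) (hA : A.PosSemidef) : (K * A).trace.re ≤ A.trace.re := by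
  have h1 : (1 - Kᴴ * K) + (K - 1)ᴴ * (K - 1) = 1 + 1 - K - Kᴴ := by
    simp only [conjTranspose_sub, conjTranspose_one, Matrix.mul_sub, Matrix.sub_mul, Matrix.mul_one,
      Matrix.one_mul]
    abel
  have h2 := trace_mul_nonneg (hK.add (posSemidef_conjTranspose_mul_self (K - 1))) hA
  have h3 : (Kᴴ * A).trace = star (K * A).trace := by
    rw [← trace_conjTranspose, conjTranspose_mul, hA.isHermitian.eq, Matrix.trace_mul_comm]
  rw [h1, Matrix.sub_mul, Matrix.sub_mul, Matrix.add_mul, Matrix.one_mul, trace_sub, trace_sub,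
    trace_add, h3] at h2
  have h4 := (Complex.le_def.1 h2).1
  simp at h4
  linarith

theorem traceNorm_nonneg [DecidableEq n] (X : Op n) : 0 ≤ traceNorm X :=
  (Complex.le_def.1 (nonneg_iff_posSemidef.1 (CFC.sqrt_nonneg (Xᴴ * X))).trace_nonneg).1

theorem exists_polar_traceNorm [DecidableEq n] (M : Op n) :
    ∃ U A : Op n, A.PosSemidef ∧ U * A = M ∧ (1 - Uᴴ * U).PosSemidef ∧ Uᴴ * M = A ∧
      traceNorm M = A.trace.re := by
  have hA := nonneg_iff_posSemidef.1 (CFC.sqrt_nonneg (Mᴴ * M))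
  obtain ⟨U, h1, h2, h3⟩ := exists_polar hA (B := M) (CFC.sqrt_mul_sqrt_self (Mᴴ * M)
    (nonneg_iff_posSemidef.2 (posSemidef_conjTranspose_mul_self M))).symm
  exact ⟨U, _, hA, h1, h2, h3, rfl⟩

/-- Factor the block as a Gram matrix and polar-decompose its two column groups against `√ω` and
`√τ`. Then `X = √τ V₂† V₁ √ω`, so its trace is that of a contraction times `√ω √τ`. -/
theorem re_trace_le_of_fromBlocks_posSemidef [DecidableEq n] {ω τ X : Op n}
    (h : (fromBlocks ω Xᴴ X τ).PosSemidef) :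
    X.trace.re ≤ traceNorm (CFC.sqrt ω * CFC.sqrt τ) := by
  have hω : ω.PosSemidef := h.submatrix Sum.inl
  have hτ : τ.PosSemidef := h.submatrix Sum.inr
  obtain ⟨C, hC⟩ := exists_eq_conjTranspose_mul_self h
  have h11 : (C.submatrix id Sum.inl)ᴴ * C.submatrix id Sum.inl = ω :=
    (congrArg toBlocks₁₁ hC).symm
  have h21 : (C.submatrix id Sum.inr)ᴴ * C.submatrix id Sum.inl = X :=
    (congrArg toBlocks₂₁ hC).symm
  have h22 : (C.submatrix id Sum.inr)ᴴ * C.submatrix id Sum.inr = τ :=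
    (congrArg toBlocks₂₂ hC).symm
  have hsω := nonneg_iff_posSemidef.1 (CFC.sqrt_nonneg ω)
  have hsτ := nonneg_iff_posSemidef.1 (CFC.sqrt_nonneg τ)
  obtain ⟨V₁, hV₁, hc₁, -⟩ := exists_polar hsω
    (h11.trans (CFC.sqrt_mul_sqrt_self ω (nonneg_iff_posSemidef.2 hω)).symm)
  obtain ⟨V₂, hV₂, hc₂, -⟩ := exists_polar hsτ
    (h22.trans (CFC.sqrt_mul_sqrt_self τ (nonneg_iff_posSemidef.2 hτ)).symm)
  obtain ⟨U, A, hA, hU, hc, -, hn⟩ := exists_polar_traceNorm (CFC.sqrt ω * CFC.sqrt τ)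
  have hX : X.trace = (V₂ᴴ * V₁ * U * A).trace := by
    rw [Matrix.mul_assoc _ U, hU, ← h21, ← hV₁, ← hV₂, conjTranspose_mul, hsτ.isHermitian.eq,
      Matrix.mul_assoc, Matrix.trace_mul_comm]
    simp only [Matrix.mul_assoc]
  rw [hX, hn]
  exact re_trace_contraction_mul_le
    (contraction_mul (contraction_mul (contraction_conjTranspose hc₂) hc₁) hc) hA

theorem fromBlocks_zero_posSemidef {A : Matrix m m ℂ} {D : Matrix n n ℂ} (hA : A.PosSemidef)
    (hD : D.PosSemidef) : (fromBlocks A 0 0 D).PosSemidef := by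
  obtain ⟨B, rfl⟩ := exists_eq_conjTranspose_mul_self hA
  obtain ⟨C, rfl⟩ := exists_eq_conjTranspose_mul_self hD
  have : fromBlocks (Bᴴ * B) 0 0 (Cᴴ * C) = (fromBlocks B 0 0 C)ᴴ * fromBlocks B 0 0 C := by
    simp [fromBlocks_conjTranspose, fromBlocks_multiply]
  rw [this]
  exact posSemidef_conjTranspose_mul_self _

theorem exists_fromBlocks_posSemidef_re_trace_eq [DecidableEq n] {ω τ : Op n}
    (hω : ω.PosSemidef) (hτ : τ.PosSemidef) :
    ∃ X : Op n, (fromBlocks ω Xᴴ X τ).PosSemidef ∧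
      X.trace.re = traceNorm (CFC.sqrt ω * CFC.sqrt τ) := by
  obtain ⟨U, A, hA, hU, hc, hUA, hn⟩ := exists_polar_traceNorm (CFC.sqrt ω * CFC.sqrt τ)
  have hsω : (CFC.sqrt ω)ᴴ = CFC.sqrt ω :=
    (nonneg_iff_posSemidef.1 (CFC.sqrt_nonneg ω)).isHermitian
  have hsτ : (CFC.sqrt τ)ᴴ = CFC.sqrt τ :=
    (nonneg_iff_posSemidef.1 (CFC.sqrt_nonneg τ)).isHermitian
  have hω2 := CFC.sqrt_mul_sqrt_self ω (nonneg_iff_posSemidef.2 hω)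
  have hτ2 := CFC.sqrt_mul_sqrt_self τ (nonneg_iff_posSemidef.2 hτ)
  -- Here `U` is only a contraction, so the Gram matrix of `√ω` and `U √τ` falls short of `τ` in the
  -- corner by `√τ (1 - U†U) √τ`, which is added separately.
  refine ⟨CFC.sqrt τ * Uᴴ * CFC.sqrt ω, ?_, ?_⟩
  · have key : fromBlocks ω (CFC.sqrt τ * Uᴴ * CFC.sqrt ω)ᴴ (CFC.sqrt τ * Uᴴ * CFC.sqrt ω) τ =
        (fromBlocks (CFC.sqrt ω) (U * CFC.sqrt τ) 0 0)ᴴ *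
          fromBlocks (CFC.sqrt ω) (U * CFC.sqrt τ) (0 : Op n) 0 +
        (fromBlocks 0 0 0 (CFC.sqrt τ))ᴴ * fromBlocks (0 : Op n) 0 0 (1 - Uᴴ * U) *
          fromBlocks 0 0 0 (CFC.sqrt τ) := by
      simp only [fromBlocks_conjTranspose, fromBlocks_multiply, fromBlocks_add, conjTranspose_mul,
        conjTranspose_zero, hsω, hsτ, conjTranspose_conjTranspose, Matrix.mul_zero, Matrix.zero_mul,
        add_zero, zero_add, hω2]
      congr 1
      simp only [Matrix.mul_sub, Matrix.sub_mul, Matrix.mul_one, Matrix.mul_assoc, hτ2]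
      abel
    rw [key]
    exact (posSemidef_conjTranspose_mul_self _).add
      ((fromBlocks_zero_posSemidef PosSemidef.zero hc).conjTranspose_mul_mul_same _)
  · rw [hn, ← hUA, Matrix.mul_assoc, Matrix.trace_mul_comm, Matrix.mul_assoc]

/-- Compressing the block by the column `(1, -1)` gives `ω + τ - X - X† ≥ 0`. -/
theorem two_mul_re_trace_le [DecidableEq n] {ω τ X : Op n}
    (h : (fromBlocks ω Xᴴ X τ).PosSemidef) :
    2 * X.trace.re ≤ ω.trace.re + τ.trace.re := by
  have h1 := (h.conjTranspose_mul_mul_same (fromRows (1 : Op n) (-1))).trace_nonneg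
  rw [conjTranspose_fromRows_eq_fromCols_conjTranspose, Matrix.mul_assoc, fromBlocks_mul_fromRows,
    fromCols_mul_fromRows] at h1
  have h2 := (Complex.le_def.1 h1).1
  simp [trace_conjTranspose] at h2
  linarith

end MatrixLemmas

/-! ### Choi operators and the contraction product -/

section Choi

variable {r s c d : Type*}

/-- The operator on `RD` obtained by contracting an operator on `RC` with one on `CD`. -/
def contract [Fintype c] (X : Op (r × c)) (J : Op (c × d)) : Op (r × d) :=
  Matrix.of fun x y => ∑ i, ∑ j, X (x.1, i) (y.1, j) * J (i, x.2) (j, y.2)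

theorem posSemidef_sum_sum [Fintype s] [Fintype c] {Y : Op (s × c)} (hY : Y.PosSemidef) :
    (Matrix.of fun x y : s => ∑ i, ∑ j, Y (x, i) (y, j)).PosSemidef := by
  obtain ⟨C, rfl⟩ := exists_eq_conjTranspose_mul_self hY
  have : (Matrix.of fun x y : s => ∑ i, ∑ j, (Cᴴ * C) (x, i) (y, j)) =
      (Matrix.of fun (q : s × c) (x : s) => ∑ i, C q (x, i))ᴴ *
        Matrix.of fun (q : s × c) (x : s) => ∑ i, C q (x, i) := by
    ext x y
    simp only [Matrix.mul_apply, of_apply, conjTranspose_apply, star_sum, Finset.sum_mul_sum]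
    simp_rw [Finset.sum_comm (s := (Finset.univ : Finset c)) (t := (Finset.univ : Finset (s × c)))]
  rw [this]
  exact posSemidef_conjTranspose_mul_self _

/-- The contraction is the compression of `X ⊗ J` by the unnormalized maximally entangled vector on
the two copies of `c`. -/
theorem posSemidef_contract [Fintype r] [Fintype c] [Fintype d] {X : Op (r × c)} {J : Op (c × d)}
    (hX : X.PosSemidef) (hJ : J.PosSemidef) : (contract X J).PosSemidef := by
  classical
  let f : (r × d) × c → (r × c) × (c × d) := fun z => ((z.1.1, z.2), (z.2, z.1.2))
  exact posSemidef_sum_sum (Y := (X ⊗ₖ J).submatrix f f) ((hX.kronecker hJ).submatrix f)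

theorem choi_apply [DecidableEq c] (Φ : Op c →ₗ[ℂ] Op d) (i j : c) (x y : d) :
    choi Φ (i, x) (j, y) = Φ (Matrix.single i j 1) x y := by
  have : (Matrix.of fun k l : c => maxEnt c (i, k) (j, l)) = Matrix.single i j 1 := by
    ext k l
    by_cases h1 : i = k <;> by_cases h2 : j = l <;>
      simp [maxEnt, maxEntVec, vecMulVec_apply, Matrix.single, h1, h2]
  simp only [choi, idTensor, of_apply, this]

variable [Fintype c]

theorem trace_eq_trace_traceSnd [Fintype d] (J : Op (c × d)) : J.trace = (traceSnd J).trace := by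
  simp [Matrix.trace, traceSnd, Fintype.sum_prod_type]

variable [DecidableEq c]

theorem apply_eq_sum_choi (Φ : Op c →ₗ[ℂ] Op d) (X : Op c) (x y : d) :
    Φ X x y = ∑ i, ∑ j, X i j * choi Φ (i, x) (j, y) := by
  conv_lhs => rw [matrix_eq_sum_single X]
  simp only [map_sum, Matrix.sum_apply, choi_apply]
  refine Finset.sum_congr rfl fun i _ => Finset.sum_congr rfl fun j _ => ?_
  have : Matrix.single i j (X i j) = X i j • Matrix.single i j (1 : ℂ) := by simp
  rw [this, map_smul, Matrix.smul_apply, smul_eq_mul]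

theorem idTensor_eq_contract (Φ : Op c →ₗ[ℂ] Op d) (X : Op (r × c)) :
    idTensor r Φ X = contract X (choi Φ) := by
  ext x y
  simp only [idTensor, contract, of_apply]
  rw [apply_eq_sum_choi]
  rfl

theorem posSemidef_maxEnt : (maxEnt c).PosSemidef := posSemidef_vecMulVec_self_star _

theorem isCompletelyPositive_iff [Fintype d] (Φ : Op c →ₗ[ℂ] Op d) :
    IsCompletelyPositive Φ ↔ (choi Φ).PosSemidef := by
  refine ⟨fun h => ?_, fun h k X hX => ?_⟩
  · let e := Fintype.equivFin c
    have h1 := (h _ _ ((posSemidef_maxEnt (c := c)).submatrix (Prod.map e.symm id))).submatrix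
      (Prod.map e id)
    convert h1 using 1
    ext x y
    simp [choi, idTensor]
  · rw [idTensor_eq_contract]
    exact posSemidef_contract hX h

theorem trace_apply_eq_sum [Fintype d] (Φ : Op c →ₗ[ℂ] Op d) (X : Op c) :
    (Φ X).trace = ∑ i, ∑ j, X i j * traceSnd (choi Φ) i j := by
  simp only [Matrix.trace, diag_apply, apply_eq_sum_choi Φ X, traceSnd, of_apply, Finset.mul_sum]
  rw [Finset.sum_comm]
  exact Finset.sum_congr rfl fun i _ => Finset.sum_comm

theorem isChannel_iff [Fintype d] (Φ : Op c →ₗ[ℂ] Op d) :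
    IsChannel Φ ↔ (choi Φ).PosSemidef ∧ traceSnd (choi Φ) = 1 := by
  refine ⟨fun h => ⟨(isCompletelyPositive_iff Φ).1 h.1, ?_⟩, fun h =>
    ⟨(isCompletelyPositive_iff Φ).2 h.1, fun X => ?_⟩⟩
  · ext i j
    have h1 := h.2 (Matrix.single i j 1)
    simp only [traceSnd, of_apply, choi_apply]
    refine Eq.trans h1 ?_
    by_cases hij : i = j
    · subst hij; simp
    · simp [hij, trace_single_eq_of_ne]
  · rw [trace_apply_eq_sum, h.2]
    simp [Matrix.one_apply, Matrix.trace]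

theorem trace_choi [Fintype d] {Φ : Op c →ₗ[ℂ] Op d} (h : IsChannel Φ) :
    (choi Φ).trace = Fintype.card c := by
  rw [trace_eq_trace_traceSnd, ((isChannel_iff Φ).1 h).2, trace_one]

/-- The linear map with a given Choi operator. -/
def ofChoi (J : Op (c × d)) : Op c →ₗ[ℂ] Op d where
  toFun X := Matrix.of fun x y => ∑ i, ∑ j, X i j * J (i, x) (j, y)
  map_add' X Y := by
    ext x y
    simp [add_mul, Finset.sum_add_distrib]
  map_smul' z X := by
    ext x y
    simp [mul_assoc, Finset.mul_sum]

theorem choi_ofChoi (J : Op (c × d)) : choi (ofChoi J) = J := by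
  ext ⟨i, x⟩ ⟨j, y⟩
  rw [choi_apply]
  simp [ofChoi, Matrix.single, ite_and]

end Choi

/-! ### The PPT condition and the simulation on Choi operators -/

section Bipartite

variable {a b ah bh a' b' : Type*} [DecidableEq a] [DecidableEq b]

/-- Transposing Bob's input before applying the map permutes matrix units, which is the same as
transposing the input leg of the Choi operator. -/
theorem transposeSnd_regroup_choi (P : Op (a × b) →ₗ[ℂ] Op (a' × b')) :
    transposeSnd (a × a') (b × b') (regroup (choi P)) =
      regroup (choi (transposeSnd a' b' ∘ₗ P ∘ₗ transposeSnd a b)) := by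
  ext ⟨⟨i, x⟩, ⟨k, z⟩⟩ ⟨⟨j, y⟩, ⟨l, w⟩⟩
  have h : transposeSnd a b (Matrix.single (i, k) (j, l) 1) = Matrix.single (i, l) (j, k) 1 := by
    ext ⟨p, q⟩ ⟨p', q'⟩
    change Matrix.single (i, k) (j, l) (1 : ℂ) (p, q') (p', q) = _
    simp only [Matrix.single, of_apply, Prod.mk.injEq]
    exact if_congr (by tauto) rfl rfl
  change choi P ((i, l), (x, w)) ((j, k), (y, z)) =
    choi (transposeSnd a' b' ∘ₗ P ∘ₗ transposeSnd a b) ((i, k), (x, z)) ((j, l), (y, w))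
  rw [choi_apply, choi_apply, LinearMap.comp_apply, LinearMap.comp_apply, h]
  rfl

variable [Fintype a] [Fintype b] [Fintype a'] [Fintype b']

theorem isCPPTP_iff (P : Op (a × b) →ₗ[ℂ] Op (a' × b')) :
    IsCPPTP P ↔ (choi P).PosSemidef ∧ traceSnd (choi P) = 1 ∧
      (transposeSnd (a × a') (b × b') (regroup (choi P))).PosSemidef := by
  have h1 := isChannel_iff P
  have h2 : IsCompletelyPositive (transposeSnd a' b' ∘ₗ P ∘ₗ transposeSnd a b) ↔
      (transposeSnd (a × a') (b × b') (regroup (choi P))).PosSemidef := by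
    rw [isCompletelyPositive_iff, transposeSnd_regroup_choi]
    exact (posSemidef_submatrix_equiv (Equiv.prodProdProdComm a b a' b').symm).symm
  exact ⟨fun h => ⟨(h1.1 h.1).1, (h1.1 h.1).2, h2.1 h.2⟩,
    fun h => ⟨h1.2 ⟨h.1, h.2.1⟩, h2.2 h.2.2⟩⟩

variable [DecidableEq a'] [DecidableEq b'] [Fintype ah] [Fintype bh]

theorem contractResource_apply (ρ : Op (ah × bh)) (P : Op (((a × ah) × (b × bh)) × (a' × b')))
    (i j : (a × b) × (a' × b')) :
    contractResource ρ P i j = ∑ h, ∑ h', ρ h h' *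
      P (((i.1.1, h.1), (i.1.2, h.2)), i.2) (((j.1.1, h'.1), (j.1.2, h'.2)), j.2) := by
  simp only [contractResource, traceFst, of_apply, Matrix.mul_apply, kroneckerMap_apply,
    Fintype.sum_prod_type (α₁ := ah × bh), transpose_apply, Matrix.one_apply, mul_ite, mul_one,
    mul_zero, ite_mul, zero_mul, Finset.sum_ite_eq, Finset.mem_univ, if_true]
  rw [Finset.sum_comm]
  rfl

theorem posSemidef_contractResource {ρ : Op (ah × bh)} (hρ : ρ.PosSemidef)
    {P : Op (((a × ah) × (b × bh)) × (a' × b'))} (hP : P.PosSemidef) :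
    (contractResource ρ P).PosSemidef := by
  have h := (posSemidef_contract (hρ.submatrix (Prod.snd : Unit × (ah × bh) → ah × bh))
    (hP.submatrix (resourceFirst a b ah bh a' b').symm)).submatrix
      fun x : (a × b) × (a' × b') => ((), x)
  convert h using 1
  ext i j
  rw [contractResource_apply]
  rfl

variable [DecidableEq ah] [DecidableEq bh]

theorem choi_simulate (ρ : Op (ah × bh)) (P : Op ((a × ah) × (b × bh)) →ₗ[ℂ] Op (a' × b')) :
    choi (simulate ρ P) = contractResource ρ (choi P) := by
  ext ⟨i, x⟩ ⟨j, y⟩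
  rw [choi_apply, contractResource_apply]
  change P (regroup (Matrix.single i j 1 ⊗ₖ ρ)) x y = _
  rw [apply_eq_sum_choi]
  rw [← (Equiv.prodProdProdComm a b ah bh).sum_comp]
  simp_rw [← (Equiv.prodProdProdComm a b ah bh).sum_comp]
  simp only [regroup, reindex_apply, submatrix_apply, Equiv.symm_apply_apply, kroneckerMap_apply,
    Fintype.sum_prod_type (α₁ := a × b), Matrix.single, of_apply]
  rw [Finset.sum_eq_single i _ (by simp)]
  · refine Finset.sum_congr rfl fun h _ => ?_
    rw [Finset.sum_eq_single j _ (by simp)]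
    · simp
    · intro k _ hk
      simp [hk.symm]
  · intro k _ hk
    simp [hk.symm]

theorem isChannel_simulate {ρ : Op (ah × bh)} (hρ : IsState ρ)
    {P : Op ((a × ah) × (b × bh)) →ₗ[ℂ] Op (a' × b')} (hP : IsChannel P) :
    IsChannel (simulate ρ P) := by
  refine ⟨?_, fun ω => ?_⟩
  · rw [isCompletelyPositive_iff, choi_simulate]
    exact posSemidef_contractResource hρ.1 ((isChannel_iff P).1 hP).1
  · change (P (regroup (ω ⊗ₖ ρ))).trace = _
    have h : (regroup (ω ⊗ₖ ρ)).trace = (ω ⊗ₖ ρ).trace :=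
      (Equiv.prodProdProdComm a b ah bh).symm.sum_comp fun i => (ω ⊗ₖ ρ) i i
    rw [hP.2, h, trace_kronecker, hρ.2, mul_one]

end Bipartite

/-! ### Separating a convex set of operators by a state -/

section Separation

variable {c : Type*} [Fintype c] [DecidableEq c]

theorem re_trace_mul_realPart {T : Op c} (hT : T.IsHermitian) (X : Op c) :
    (T * (ℜ X : Op c)).trace.re = (T * X).trace.re := by
  have h : (T * Xᴴ).trace = star (T * X).trace := by
    rw [← trace_conjTranspose, conjTranspose_mul, hT.eq, Matrix.trace_mul_comm]
  rw [realPart_apply_coe, star_eq_conjTranspose, mul_smul_comm, Matrix.mul_add, trace_smul,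
    trace_add, h]
  simp
  ring

theorem smul_one_le_realPart_iff (lam : ℝ) (X : Op c) :
    (lam : ℂ) • (1 : Op c) ≤ (ℜ X : Op c) ↔
      ∀ T : Op c, T.PosSemidef → lam * T.trace.re ≤ (T * X).trace.re := by
  have key : ∀ T : Op c, T.PosSemidef →
      (T * ((ℜ X : Op c) - (lam : ℂ) • 1)).trace.re = (T * X).trace.re - lam * T.trace.re := by
    intro T hT
    rw [Matrix.mul_sub, trace_sub, Complex.sub_re, re_trace_mul_realPart hT.isHermitian]
    simp
  rw [Matrix.le_iff]
  refine ⟨fun h T hT => ?_, fun h => PosSemidef.of_dotProduct_mulVec_nonneg ?_ fun v => ?_⟩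
  · have h1 := (Complex.le_def.1 (trace_mul_nonneg hT h)).1
    rw [key T hT, Complex.zero_re] at h1
    linarith
  · refine IsHermitian.sub (ℜ X).2 ?_
    rw [IsHermitian, conjTranspose_smul, conjTranspose_one]
    simp
  · have hH : ((ℜ X : Op c) - (lam : ℂ) • 1).IsHermitian := by
      refine IsHermitian.sub (ℜ X).2 ?_
      rw [IsHermitian, conjTranspose_smul, conjTranspose_one]
      simp
    have hv := posSemidef_vecMulVec_self_star v
    have h2 := h _ hv
    have h3 := key _ hv
    rw [Matrix.trace_mul_comm, mul_vecMulVec, trace_vecMulVec, dotProduct_comm] at h3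
    refine Complex.le_def.2 ⟨?_, ?_⟩
    · rw [h3, Complex.zero_re]; linarith
    · exact (hH.im_star_dotProduct_mulVec_self v).symm

open scoped Matrix.Norms.L2Operator in
theorem neg_norm_mul_trace_le {T : Op c} (hT : T.PosSemidef) (W : Op c) :
    -‖W‖ * T.trace.re ≤ (T * W).trace.re := by
  refine (smul_one_le_realPart_iff (-‖W‖) W).1 ?_ T hT
  have h1 : -(algebraMap ℝ (Op c) ‖(ℜ W : Op c)‖) ≤ (ℜ W : Op c) :=
    IsSelfAdjoint.neg_algebraMap_norm_le_self (ℜ W).2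
  refine le_trans ?_ h1
  have h2 : ‖(ℜ W : Op c)‖ ≤ ‖W‖ := realPart.norm_le W
  have h3 : algebraMap ℝ (Op c) ‖(ℜ W : Op c)‖ ≤ algebraMap ℝ (Op c) ‖W‖ :=
    algebraMap_mono _ h2
  have h4 : ((-‖W‖ : ℝ) : ℂ) • (1 : Op c) = -(algebraMap ℝ (Op c) ‖W‖) := by
    rw [Algebra.algebraMap_eq_smul_one]
    ext i j
    simp
  rw [h4]
  exact neg_le_neg h3

open scoped Matrix.Norms.L2Operator in
/-- A convex set of operators either contains one with `ℜ Z ≥ f I`, or some state bounds the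
expectation values of all of them by `f`. -/
theorem exists_le_realPart_or_exists_isState {K : Set (Op c)} (hK : Convex ℝ K)
    (hne : K.Nonempty) (f : ℝ) :
    (∃ Z ∈ K, (f : ℂ) • (1 : Op c) ≤ (ℜ Z : Op c)) ∨
      ∃ σ : Op c, IsState σ ∧ ∀ Z ∈ K, (σ * Z).trace.re ≤ f := by
  -- The uniform slack `ε` makes this set open, as the separation theorem requires.
  let S : Set (Op c) := {X | ∃ ε > 0, ∀ T : Op c, T.PosSemidef →
    (f + ε) * T.trace.re ≤ (T * X).trace.re}
  have trace_re_nonneg : ∀ T : Op c, T.PosSemidef → 0 ≤ T.trace.re :=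
    fun T hT => (Complex.le_def.1 hT.trace_nonneg).1
  by_cases hdisj : Disjoint S K
  swap
  · obtain ⟨Z, ⟨ε, hε, hZ⟩, hZK⟩ := Set.not_disjoint_iff.1 hdisj
    refine Or.inl ⟨Z, hZK, (smul_one_le_realPart_iff _ _).2 fun T hT => ?_⟩
    nlinarith [hZ T hT, trace_re_nonneg T hT]
  right
  have hSconv : Convex ℝ S := by
    rintro X ⟨ε, hε, hX⟩ Y ⟨δ, hδ, hY⟩ α β hα hβ hαβ
    refine ⟨α * ε + β * δ, ?_, fun T hT => ?_⟩
    · rcases hα.eq_or_lt with h | h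
      · have : β = 1 := by linarith
        subst this; subst h; simpa using hδ
      · positivity
    · have h1 : (T * (α • X + β • Y)).trace.re = α * (T * X).trace.re + β * (T * Y).trace.re := by
        simp [Matrix.mul_add]
      have h2 : f = α * f + β * f := by rw [← add_mul, hαβ, one_mul]
      rw [h1]
      have := mul_le_mul_of_nonneg_left (hX T hT) hα
      have := mul_le_mul_of_nonneg_left (hY T hT) hβ
      calc _ = α * ((f + ε) * T.trace.re) + β * ((f + δ) * T.trace.re) := by
            linear_combination T.trace.re * h2
        _ ≤ _ := by linarith
  have hSopen : IsOpen S := by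
    rw [Metric.isOpen_iff]
    rintro X ⟨ε, hε, hX⟩
    refine ⟨ε / 2, by positivity, fun Y hY => ⟨ε / 2, by positivity, fun T hT => ?_⟩⟩
    rw [mem_ball_iff_norm] at hY
    have h1 := neg_norm_mul_trace_le hT (Y - X)
    rw [Matrix.mul_sub, trace_sub, Complex.sub_re] at h1
    nlinarith [hX T hT, trace_re_nonneg T hT]
  obtain ⟨ℓ, u, hS, hKu⟩ :=
    RCLike.geometric_hahn_banach_open (𝕜 := ℂ) hSconv hSopen hK hdisj
  simp only [RCLike.re_to_complex] at hS hKu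
  have hmem : ∀ ε > 0, ∀ P : Op c, (∀ T : Op c, T.PosSemidef → 0 ≤ (T * P).trace.re) →
      ((f + ε : ℝ) : ℂ) • (1 : Op c) + P ∈ S := by
    intro ε hε P hP
    refine ⟨ε, hε, fun T hT => ?_⟩
    have := hP T hT
    rw [Matrix.mul_add, trace_add, Complex.add_re]
    simp only [mul_smul_comm, Matrix.mul_one, trace_smul, smul_eq_mul, Complex.re_ofReal_mul]
    linarith
  have hcone : ∀ P : Op c, (∀ T : Op c, T.PosSemidef → 0 ≤ (T * P).trace.re) → (ℓ P).re ≤ 0 := by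
    intro P hP
    by_contra! hlt
    -- Adding multiples `t • P` never leaves `S`, on which `Re ℓ` stays below `u`; a positive slope
    -- is impossible.
    have hbound : ∀ t : ℝ, 0 ≤ t →
        (ℓ (((f + 1 : ℝ) : ℂ) • (1 : Op c))).re + t * (ℓ P).re < u := by
      intro t ht
      have := hS _ (hmem 1 one_pos ((t : ℂ) • P) fun T hT => by
        simpa using mul_nonneg ht (hP T hT))
      rw [map_add, map_smul ℓ (t : ℂ) P, Complex.add_re, smul_eq_mul,
        Complex.re_ofReal_mul] at this
      exact this
    set w := (ℓ (((f + 1 : ℝ) : ℂ) • (1 : Op c))).re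
    have h1 := hbound 0 le_rfl
    have h2 := hbound ((u - w) / (ℓ P).re) (div_nonneg (by linarith) hlt.le)
    rw [div_mul_cancel₀ _ hlt.ne'] at h2
    linarith
  -- Anti-Hermitian operators pair with positive ones to real part zero, so they lie in the cone;
  -- this forces `ℓ` to respect adjoints.
  have hre : ∀ X : Op c, (ℓ X).re ≤ (ℓ Xᴴ).re := by
    intro X
    have := hcone (X - Xᴴ) fun T hT => by
      have h : (T * Xᴴ).trace = star (T * X).trace := by
        rw [← trace_conjTranspose, conjTranspose_mul, hT.isHermitian.eq, Matrix.trace_mul_comm]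
      rw [Matrix.mul_sub, trace_sub, h]
      simp
    rw [map_sub, Complex.sub_re] at this
    linarith
  have hconj : ∀ X : Op c, ℓ Xᴴ = star (ℓ X) := by
    intro X
    have h1 := hre X
    have h2 := hre Xᴴ
    have h3 := hre (Complex.I • X)
    have h4 := hre (-Complex.I • X)
    rw [conjTranspose_conjTranspose] at h2
    rw [conjTranspose_smul, map_smul, map_smul] at h3 h4
    simp at h3 h4
    exact Complex.ext (by simp; linarith) (by simp; linarith)
  have hpos : ∀ P : Op c, P.PosSemidef → 0 ≤ -(ℓ P) := by
    intro P hP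
    have h1 := hcone P fun T hT => (Complex.le_def.1 (trace_mul_nonneg hT hP)).1
    have h2 := congrArg Complex.im (hconj P)
    rw [hP.isHermitian.eq] at h2
    simp at h2
    refine Complex.le_def.2 ⟨by simpa using h1, ?_⟩
    simp; linarith
  -- The operator representing `-ℓ` in the trace pairing; normalized, it is the required state.
  let Y : Op c := Matrix.of fun i j => -ℓ (Matrix.single j i 1)
  have hY : ∀ X : Op c, (Y * X).trace = -ℓ X := by
    intro X
    conv_rhs => rw [matrix_eq_sum_single X]
    have : ∀ i j, ℓ (Matrix.single i j (X i j)) = X i j * ℓ (Matrix.single i j 1) := by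
      intro i j
      have : Matrix.single i j (X i j) = X i j • Matrix.single i j (1 : ℂ) := by simp
      rw [this, map_smul, smul_eq_mul]
    simp only [map_sum, this, Matrix.trace, diag_apply, Matrix.mul_apply, Y, of_apply]
    rw [Finset.sum_comm]
    simp [mul_comm]
  have hYv : ∀ v : c → ℂ, 0 ≤ star v ⬝ᵥ (Y *ᵥ v) := by
    intro v
    have h := hpos _ (posSemidef_vecMulVec_self_star v)
    rwa [← hY, mul_vecMulVec, trace_vecMulVec, dotProduct_comm] at h
  have hYpos : Y.PosSemidef := by
    rw [posSemidef_iff_dotProduct_mulVec]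
    refine ⟨?_, hYv⟩
    ext i j
    have h := hconj (Matrix.single j i 1)
    simp only [conjTranspose_single, star_one] at h
    simp [Y, h]
  have hYone : Y.trace = -ℓ 1 := by rw [← hY, Matrix.mul_one]
  obtain ⟨Z₀, hZ₀⟩ := hne
  have hlt : ∀ Z ∈ K, ∀ ε > 0, (Y * Z).trace.re < (f + ε) * Y.trace.re := by
    intro Z hZ ε hε
    have h1 := hS _ (hmem ε hε 0 (by simp))
    have h2 := hKu Z hZ
    rw [hY, hYone]
    rw [add_zero, map_smul, smul_eq_mul, Complex.re_ofReal_mul] at h1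
    simp only [Complex.neg_re]
    linarith
  have hYre : (Y.trace.re : ℂ) = Y.trace :=
    Complex.ext rfl (Complex.le_def.1 hYpos.trace_nonneg).2
  have hT : 0 < Y.trace.re := by
    refine lt_of_le_of_ne (trace_re_nonneg Y hYpos) fun h => ?_
    rw [← h, Complex.ofReal_zero] at hYre
    -- Trace zero would give `Y = 0`, and the strict separation would read `0 < 0`.
    have hY0 := hYpos.trace_eq_zero_iff.1 hYre.symm
    have := hlt Z₀ hZ₀ 1 one_pos
    simp [hY0] at this
  refine ⟨((Y.trace.re⁻¹ : ℝ) : ℂ) • Y, ⟨hYpos.smul ?_, ?_⟩, fun Z hZ => ?_⟩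
  · exact_mod_cast inv_nonneg.2 hT.le
  · rw [trace_smul, ← hYre, smul_eq_mul, Complex.ofReal_re]
    exact_mod_cast inv_mul_cancel₀ hT.ne'
  · rw [smul_mul_assoc, trace_smul, smul_eq_mul, Complex.re_ofReal_mul, inv_mul_le_iff₀ hT]
    refine le_of_forall_pos_le_add fun δ hδ => ?_
    have := hlt Z hZ (δ / Y.trace.re) (by positivity)
    rw [add_mul, div_mul_cancel₀ _ hT.ne', mul_comm f] at this
    exact this.le

end Separation

/-! ### Root channel fidelity as an optimum over blocks of Choi operators -/

section ChannelFidelity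

variable {r c d : Type*}

theorem convex_block (J J' : Op (c × d)) :
    Convex ℝ {Q : Op (c × d) | (fromBlocks J Qᴴ Q J').PosSemidef} := by
  intro Q hQ Q' hQ' α β hα hβ hαβ
  have h := (PosSemidef.smul hQ hα).add (PosSemidef.smul hQ' hβ)
  simp only [fromBlocks_smul, fromBlocks_add, ← add_smul, hαβ, one_smul] at h
  simpa using h

variable [Fintype r]

theorem posSemidef_traceFst {ρ : Op (r × c)} (hρ : ρ.PosSemidef) : (traceFst ρ).PosSemidef := by
  have h := posSemidef_sum Finset.univ fun k (_ : k ∈ Finset.univ) => hρ.submatrix fun i : c => (k, i)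
  convert h using 1
  ext i j
  simp [traceFst, Matrix.sum_apply]

variable [Fintype c] [Fintype d]

/-- The block is a positive operator on `c × (d ⊕ d)`, so a single contraction with `ρ` handles all
four corners. -/
theorem contract_fromBlocks_posSemidef {ρ : Op (r × c)} (hρ : ρ.PosSemidef)
    {J J' Q : Op (c × d)} (h : (fromBlocks J Qᴴ Q J').PosSemidef) :
    (fromBlocks (contract ρ J) (contract ρ Q)ᴴ (contract ρ Q) (contract ρ J')).PosSemidef := by
  let f : c × (d ⊕ d) → (c × d) ⊕ (c × d) := fun z => z.2.map (Prod.mk z.1) (Prod.mk z.1)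
  let g : (r × d) ⊕ (r × d) → r × (d ⊕ d) :=
    Sum.elim (fun z => (z.1, Sum.inl z.2)) (fun z => (z.1, Sum.inr z.2))
  have h1 := (posSemidef_contract hρ (h.submatrix f)).submatrix g
  convert h1 using 1
  ext (x | x) (y | y)
  · rfl
  · simp only [contract, conjTranspose_apply, fromBlocks_apply₁₂, submatrix_apply, of_apply, f, g,
      Sum.elim_inl, Sum.elim_inr, Sum.map_inl, Sum.map_inr, star_sum, star_mul']
    rw [Finset.sum_comm]
    simp only [hρ.isHermitian.apply]
  · rfl
  · rfl

theorem trace_contract (ρ : Op (r × c)) (J : Op (c × d)) :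
    (contract ρ J).trace = ((traceFst ρ)ᵀ * traceSnd J).trace := by
  simp only [Matrix.trace, diag_apply, contract, of_apply, Matrix.mul_apply, traceFst, traceSnd,
    transpose_apply, Fintype.sum_prod_type, Finset.sum_mul_sum]
  simp only [Finset.sum_comm (s := (Finset.univ : Finset d)) (t := (Finset.univ : Finset c)),
    Finset.sum_comm (s := (Finset.univ : Finset r)) (t := (Finset.univ : Finset c))]
  exact Finset.sum_comm

theorem trace_traceFst (ρ : Op (r × c)) : (traceFst ρ).trace = ρ.trace := by
  simp only [Matrix.trace, traceFst, diag_apply, of_apply, Fintype.sum_prod_type]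
  exact Finset.sum_comm

variable [DecidableEq d]

theorem channelFidelity_le (N M : Op c →ₗ[ℂ] Op d) {k : ℕ} {ρ : Op (Fin k × c)}
    (hρ : IsState ρ) :
    channelFidelity N M ≤ fidelity (idTensor (Fin k) N ρ) (idTensor (Fin k) M ρ) :=
  csInf_le ⟨0, by rintro _ ⟨k, ρ, -, rfl⟩; exact sq_nonneg _⟩ ⟨k, ρ, hρ, rfl⟩

theorem channelFidelity_nonneg (N M : Op c →ₗ[ℂ] Op d) : 0 ≤ channelFidelity N M :=
  Real.sInf_nonneg (by rintro _ ⟨k, ρ, -, rfl⟩; exact sq_nonneg _)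

/-- The state of `RC` whose state vector has a given coefficient matrix. -/
theorem isState_of_coeff {k : ℕ} {s : Matrix (Fin k) c ℂ} (hs : (sᴴ * s).trace = 1) :
    IsState (vecMulVec (fun z : Fin k × c => s z.1 z.2) (star fun z : Fin k × c => s z.1 z.2)) := by
  refine ⟨posSemidef_vecMulVec_self_star _, ?_⟩
  rw [← hs, trace_vecMulVec]
  simp only [dotProduct, Matrix.trace, diag_apply, Matrix.mul_apply, conjTranspose_apply,
    Pi.star_apply, Fintype.sum_prod_type]
  rw [Finset.sum_comm]
  simp only [mul_comm]

theorem contract_coeff {k : ℕ} (s : Matrix (Fin k) c ℂ) (J : Op (c × d)) :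
    contract (vecMulVec (fun z : Fin k × c => s z.1 z.2) (star fun z : Fin k × c => s z.1 z.2)) J =
      (s ⊗ₖ (1 : Op d)) * J * (s ⊗ₖ (1 : Op d))ᴴ := by
  ext ⟨p, x⟩ ⟨q, y⟩
  simp only [contract, of_apply, vecMulVec_apply, Matrix.mul_apply, kroneckerMap_apply,
    conjTranspose_apply, Fintype.sum_prod_type, Pi.star_apply, Matrix.one_apply, mul_ite, mul_one,
    mul_zero, ite_mul, zero_mul, Finset.sum_ite_eq, Finset.mem_univ, if_true, apply_ite star,
    star_zero, Finset.sum_mul]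
  rw [Finset.sum_comm]
  refine Finset.sum_congr rfl fun i _ => Finset.sum_congr rfl fun j _ => ?_
  ring

theorem trace_kronecker_one_mul (σ : Op c) (Q : Op (c × d)) :
    ((σ ⊗ₖ (1 : Op d)) * Q).trace = (σ * traceSnd Q).trace := by
  simp only [Matrix.trace, diag_apply, Matrix.mul_apply, kroneckerMap_apply, Fintype.sum_prod_type,
    traceSnd, of_apply, Matrix.one_apply, mul_ite, mul_one, mul_zero, ite_mul, zero_mul,
    Finset.sum_ite_eq, Finset.mem_univ, if_true, Finset.mul_sum]
  exact Finset.sum_congr rfl fun i _ => Finset.sum_comm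

variable [DecidableEq c]

theorem le_traceNorm_of_block {N M : Op c →ₗ[ℂ] Op d} {Q : Op (c × d)} {lam : ℝ}
    (hQ : (fromBlocks (choi N) Qᴴ Q (choi M)).PosSemidef)
    (hlam : (lam : ℂ) • (1 : Op c) ≤ (ℜ (traceSnd Q) : Op c)) {k : ℕ} {ρ : Op (Fin k × c)}
    (hρ : IsState ρ) :
    lam ≤ traceNorm (CFC.sqrt (idTensor (Fin k) N ρ) * CFC.sqrt (idTensor (Fin k) M ρ)) := by
  rw [idTensor_eq_contract, idTensor_eq_contract]
  refine le_trans ?_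
    (re_trace_le_of_fromBlocks_posSemidef (contract_fromBlocks_posSemidef hρ.1 hQ))
  have h := (smul_one_le_realPart_iff lam _).1 hlam _ (posSemidef_traceFst hρ.1).transpose
  rw [trace_transpose, trace_traceFst, hρ.2, ← trace_contract] at h
  simpa using h

/-- For the pure input with coefficient matrix `s`, where `s†s = σ`, the outputs are `S J S†` with
`S = s ⊗ 1` invertible. The optimal `X` for these outputs pulls back along `S⁻¹`, and its trace
becomes the pairing of `σ` with the marginal. -/
theorem exists_block_of_posDef {N M : Op c →ₗ[ℂ] Op d} (hN : (choi N).PosSemidef)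
    (hM : (choi M).PosSemidef) {σ : Op c} (hσ : σ.PosDef) (hσ1 : σ.trace = 1) :
    ∃ Q : Op (c × d), (fromBlocks (choi N) Qᴴ Q (choi M)).PosSemidef ∧
      √(channelFidelity N M) ≤ (σ * traceSnd Q).trace.re := by
  obtain ⟨B, hB⟩ := exists_eq_conjTranspose_mul_self hσ.posSemidef
  let e := Fintype.equivFin c
  let s : Matrix (Fin (Fintype.card c)) c ℂ := B.submatrix e.symm id
  let t : Matrix c (Fin (Fintype.card c)) ℂ := (σ⁻¹ * Bᴴ).submatrix id e.symm
  have hs : sᴴ * s = σ := by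
    rw [hB]
    exact submatrix_mul_equiv Bᴴ B id e.symm id
  have hts : t * s = 1 := by
    have h : t * s = (σ⁻¹ * Bᴴ) * B := submatrix_mul_equiv (σ⁻¹ * Bᴴ) B id e.symm id
    rw [h, Matrix.mul_assoc, ← hB]
    exact nonsing_inv_mul _ ((isUnit_iff_isUnit_det _).1 hσ.isUnit)
  set S := s ⊗ₖ (1 : Op d) with hS
  set R := t ⊗ₖ (1 : Op d) with hR
  have hRS : R * S = 1 := by
    rw [hR, hS, ← mul_kronecker_mul, hts, Matrix.mul_one, one_kronecker_one]
  have hSR : Sᴴ * Rᴴ = 1 := by rw [← conjTranspose_mul, hRS, conjTranspose_one]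
  have hst := isState_of_coeff (hs ▸ hσ1 : (sᴴ * s).trace = 1)
  have hfid := channelFidelity_le N M hst
  rw [idTensor_eq_contract, idTensor_eq_contract, contract_coeff, contract_coeff] at hfid
  obtain ⟨X, hX, hXtr⟩ := exists_fromBlocks_posSemidef_re_trace_eq
    (hN.mul_mul_conjTranspose_same S) (hM.mul_mul_conjTranspose_same S)
  have hcancel : ∀ J : Op (c × d), R * (S * J * Sᴴ) * Rᴴ = J := by
    intro J
    rw [Matrix.mul_assoc S, ← Matrix.mul_assoc R, hRS, Matrix.one_mul, Matrix.mul_assoc J, hSR,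
      Matrix.mul_one]
  refine ⟨R * X * Rᴴ, ?_, ?_⟩
  · have h := hX.mul_mul_conjTranspose_same (fromBlocks R 0 0 R)
    simp only [fromBlocks_conjTranspose, fromBlocks_multiply, conjTranspose_zero, Matrix.mul_zero,
      Matrix.zero_mul, add_zero, zero_add, hcancel] at h
    rwa [conjTranspose_mul, conjTranspose_mul, conjTranspose_conjTranspose, ← Matrix.mul_assoc]
  · have hS2 : Sᴴ * S = σ ⊗ₖ (1 : Op d) := by
      rw [hS, conjTranspose_kronecker, ← mul_kronecker_mul, hs, conjTranspose_one, Matrix.mul_one]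
    have hSR2 : S * R = 1 := by
      rw [hS, hR, ← mul_kronecker_mul, (mul_eq_one_comm_of_equiv e).1 hts, Matrix.mul_one,
        one_kronecker_one]
    have htr : ((σ ⊗ₖ (1 : Op d)) * (R * X * Rᴴ)).trace = X.trace := by
      have : Sᴴ * S * (R * X * Rᴴ) = Sᴴ * (X * Rᴴ) := by
        rw [Matrix.mul_assoc, Matrix.mul_assoc R, ← Matrix.mul_assoc S, hSR2, Matrix.one_mul]
      rw [← hS2, this, Matrix.trace_mul_comm, Matrix.mul_assoc, ← conjTranspose_mul, hSR2,
        conjTranspose_one, Matrix.mul_one]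
    rw [← trace_kronecker_one_mul, htr, hXtr]
    exact (Real.sqrt_le_sqrt hfid).trans (Real.sqrt_sq (traceNorm_nonneg _)).le

theorem exists_block_le_realPart [Nonempty c] {N M : Op c →ₗ[ℂ] Op d} (hN : IsChannel N)
    (hM : IsChannel M) {f : ℝ} (hf : f < √(channelFidelity N M)) :
    ∃ Q : Op (c × d), (fromBlocks (choi N) Qᴴ Q (choi M)).PosSemidef ∧
      (f : ℂ) • (1 : Op c) ≤ (ℜ (traceSnd Q) : Op c) := by
  have hN1 := ((isChannel_iff N).1 hN).1
  have hM1 := ((isChannel_iff M).1 hM).1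
  let L : Op (c × d) →ₗ[ℝ] Op c :=
    { toFun := traceSnd
      map_add' := fun X Y => by ext i j; simp [traceSnd, Finset.sum_add_distrib]
      map_smul' := fun z X => by ext i j; simp [traceSnd, Finset.mul_sum] }
  have hK := (convex_block (choi N) (choi M)).linear_image L
  have hd : (0 : ℝ) < Fintype.card c := by exact_mod_cast Fintype.card_pos
  have hd' : (Fintype.card c : ℂ) ≠ 0 := by exact_mod_cast hd.ne'
  have h1 : ((Fintype.card c : ℂ)⁻¹ • (1 : Op c)).PosDef := by
    refine PosDef.smul PosDef.one ?_
    have : (0 : ℂ) < Fintype.card c := by exact_mod_cast hd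
    exact inv_pos.2 this
  have ht1 : ((Fintype.card c : ℂ)⁻¹ • (1 : Op c)).trace = 1 := by
    rw [trace_smul, trace_one, smul_eq_mul, inv_mul_cancel₀ hd']
  have hne : (L '' {Q : Op (c × d) | (fromBlocks (choi N) Qᴴ Q (choi M)).PosSemidef}).Nonempty := by
    obtain ⟨Q, hQ, -⟩ := exists_block_of_posDef hN1 hM1 h1 ht1
    exact ⟨_, Q, hQ, rfl⟩
  obtain ⟨_, ⟨Q, hQ, rfl⟩, h⟩ | ⟨σ, hσ, h⟩ := exists_le_realPart_or_exists_isState hK hne f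
  · exact ⟨Q, hQ, h⟩
  exfalso
  set F := √(channelFidelity N M)
  -- Mixing with weight `ε` gives `F ≤ (1 - ε) f + ε`, because the maximally mixed part contributes
  -- at most one. This `ε` is small enough that `ε (1 - f) < F - f`, a contradiction.
  set ε : ℝ := (F - f) / (F - f + |1 - f| + 1) with hε
  have hden : 0 < F - f + |1 - f| + 1 := by
    have := abs_nonneg (1 - f)
    linarith
  have hε0 : 0 < ε := div_pos (by linarith) hden
  have hε1 : ε < 1 := by
    rw [hε, div_lt_one hden]
    have := abs_nonneg (1 - f)
    linarith
  have hεD : ε * (F - f + |1 - f| + 1) = F - f := div_mul_cancel₀ _ hden.ne'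
  have hpd : (((1 - ε : ℝ) : ℂ) • σ + (ε : ℂ) • ((Fintype.card c : ℂ)⁻¹ • (1 : Op c))).PosDef := by
    refine PosDef.posSemidef_add (hσ.1.smul ?_) (h1.smul ?_)
    · exact_mod_cast (by linarith : (0 : ℝ) ≤ 1 - ε)
    · exact_mod_cast hε0
  obtain ⟨Q, hQ, hFQ⟩ := exists_block_of_posDef hN1 hM1 hpd (by
    rw [trace_add, trace_smul, trace_smul, ht1, hσ.2]
    push_cast
    simp)
  have h2 := h _ ⟨Q, hQ, rfl⟩
  change (σ * traceSnd Q).trace.re ≤ f at h2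
  have h3 := two_mul_re_trace_le hQ
  rw [trace_choi hN, trace_choi hM, trace_eq_trace_traceSnd, Complex.natCast_re] at h3
  have h4 : ((Fintype.card c : ℂ)⁻¹ * (traceSnd Q).trace).re ≤ 1 := by
    have : ((Fintype.card c : ℂ)⁻¹) = (((Fintype.card c : ℝ)⁻¹ : ℝ) : ℂ) := by push_cast; rfl
    rw [this, Complex.re_ofReal_mul, inv_mul_le_iff₀ hd]
    linarith
  rw [Matrix.add_mul, trace_add, smul_mul_assoc, trace_smul, smul_mul_assoc, smul_mul_assoc,
    Matrix.one_mul, trace_smul, trace_smul, Complex.add_re, smul_eq_mul, smul_eq_mul, smul_eq_mul,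
    Complex.re_ofReal_mul, Complex.re_ofReal_mul] at hFQ
  have h5 : (1 - ε) * (σ * traceSnd Q).trace.re ≤ (1 - ε) * f :=
    mul_le_mul_of_nonneg_left h2 (by linarith)
  have h6 := mul_le_mul_of_nonneg_left h4 hε0.le
  have h7 := mul_le_mul_of_nonneg_left (le_abs_self (1 - f)) hε0.le
  have h8 : 0 < ε * (F - f) := mul_pos hε0 (by linarith)
  linarith

theorem sq_le_channelFidelity [Nonempty c] {N M : Op c →ₗ[ℂ] Op d} {Q : Op (c × d)} {lam : ℝ}
    (h0 : 0 ≤ lam) (hQ : (fromBlocks (choi N) Qᴴ Q (choi M)).PosSemidef)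
    (hlam : (lam : ℂ) • (1 : Op c) ≤ (ℜ (traceSnd Q) : Op c)) :
    lam ^ 2 ≤ channelFidelity N M := by
  refine le_csInf ?_ ?_
  -- A state must be exhibited, since the real infimum of the empty set is zero.
  · obtain ⟨i⟩ := ‹Nonempty c›
    have h : IsState (Matrix.single ((0 : Fin 1), i) ((0 : Fin 1), i) (1 : ℂ)) := by
      refine ⟨?_, by simp⟩
      have := posSemidef_vecMulVec_self_star (Pi.single ((0 : Fin 1), i) (1 : ℂ))
      rw [Matrix.single_eq_single_vecMulVec_single]
      simpa using this
    exact ⟨_, 1, _, h, rfl⟩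
  · rintro _ ⟨k, ρ, hρ, rfl⟩
    exact pow_le_pow_left₀ h0 (le_traceNorm_of_block hQ hlam hρ) 2

theorem le_one_of_block [Nonempty c] {N M : Op c →ₗ[ℂ] Op d} (hN : IsChannel N)
    (hM : IsChannel M) {Q : Op (c × d)} {lam : ℝ}
    (hQ : (fromBlocks (choi N) Qᴴ Q (choi M)).PosSemidef)
    (hlam : (lam : ℂ) • (1 : Op c) ≤ (ℜ (traceSnd Q) : Op c)) : lam ≤ 1 := by
  have hd : (0 : ℝ) < Fintype.card c := by exact_mod_cast Fintype.card_pos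
  have h := (smul_one_le_realPart_iff lam _).1 hlam 1 PosSemidef.one
  have h3 := two_mul_re_trace_le hQ
  rw [trace_choi hN, trace_choi hM, trace_eq_trace_traceSnd, Complex.natCast_re] at h3
  rw [Matrix.one_mul, trace_one, Complex.natCast_re] at h
  by_contra! hlt
  nlinarith

end ChannelFidelity

/-! ### Feasible points as C-PPT-P simulations, and the main theorem -/

section Simulation

variable {a b ah bh a' b' : Type*} [Fintype a] [Fintype b] [Fintype a'] [Fintype b']
  [DecidableEq a] [DecidableEq b]

/-- The completely depolarizing channel is a C-PPT-P channel. -/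
theorem exists_isCPPTP [Nonempty a'] [Nonempty b'] :
    ∃ P : Op (a × b) →ₗ[ℂ] Op (a' × b'), IsCPPTP P := by
  classical
  have hd : (Fintype.card (a' × b') : ℂ) ≠ 0 := by exact_mod_cast Fintype.card_ne_zero
  have hd0 : (0 : ℂ) ≤ (Fintype.card (a' × b') : ℂ)⁻¹ := by
    have : (0 : ℂ) < Fintype.card (a' × b') := by exact_mod_cast Fintype.card_pos
    exact (inv_pos.2 this).le
  refine ⟨ofChoi ((Fintype.card (a' × b') : ℂ)⁻¹ • 1), ?_⟩
  rw [isCPPTP_iff, choi_ofChoi]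
  refine ⟨PosSemidef.one.smul hd0, ?_, ?_⟩
  · ext i j
    by_cases h : i = j
    · subst h
      simpa [traceSnd, Matrix.one_apply] using mul_inv_cancel₀ hd
    · simp [traceSnd, Matrix.one_apply, h]
  · have h : transposeSnd (a × a') (b × b') (regroup ((Fintype.card (a' × b') : ℂ)⁻¹ • 1)) =
        (Fintype.card (a' × b') : ℂ)⁻¹ • 1 := by
      ext ⟨⟨i, x⟩, ⟨k, z⟩⟩ ⟨⟨j, y⟩, ⟨l, w⟩⟩
      change (Fintype.card (a' × b') : ℂ)⁻¹ * (1 : Op ((a × b) × (a' × b'))) ((i, l), (x, w))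
        ((j, k), (y, z)) = (Fintype.card (a' × b') : ℂ)⁻¹ * _
      simp only [Matrix.one_apply, Prod.mk.injEq]
      congr 1
      exact if_congr (by constructor <;> rintro ⟨⟨rfl, rfl⟩, ⟨rfl, rfl⟩⟩ <;> simp) rfl rfl
    rw [h]
    exact PosSemidef.one.smul hd0

variable [Fintype ah] [Fintype bh] [DecidableEq ah] [DecidableEq bh]
  [DecidableEq a'] [DecidableEq b']

theorem mem_feasibleValues_iff {N : Op (a × b) →ₗ[ℂ] Op (a' × b')} {ρ : Op (ah × bh)} {lam : ℝ} :
    lam ∈ feasibleValues N ρ ↔ 0 ≤ lam ∧ ∃ P : Op ((a × ah) × (b × bh)) →ₗ[ℂ] Op (a' × b'),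
      IsCPPTP P ∧ ∃ Q : Op ((a × b) × (a' × b')),
        (fromBlocks (choi N) Qᴴ Q (choi (simulate ρ P))).PosSemidef ∧
        (lam : ℂ) • (1 : Op (a × b)) ≤ (ℜ (traceSnd Q) : Op (a × b)) := by
  constructor
  · rintro ⟨P, Q, h⟩
    refine ⟨h.lam_nonneg, ofChoi P, ?_, Q, ?_, h.lam_le⟩
    · rw [isCPPTP_iff, choi_ofChoi]
      exact ⟨h.posSemidef, h.tracePreserving, h.ppt⟩
    · rw [choi_simulate, choi_ofChoi]
      exact h.block
  · rintro ⟨h0, P, hP, Q, hQ, hlam⟩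
    rw [isCPPTP_iff] at hP
    rw [choi_simulate] at hQ
    exact ⟨choi P, Q, h0, hP.1, hlam, hP.2.2, hP.2.1, hQ⟩

end Simulation
end BipartiteSim

theorem mainTheorem7 {a b ah bh a' b' : Type*}
    [Fintype a] [Fintype b] [Fintype ah] [Fintype bh] [Fintype a'] [Fintype b']
    [DecidableEq a] [DecidableEq b] [DecidableEq ah] [DecidableEq bh]
    [DecidableEq a'] [DecidableEq b'] [Nonempty a] [Nonempty b]
    (N : BipartiteSim.Op (a × b) →ₗ[ℂ] BipartiteSim.Op (a' × b'))
    (hN : BipartiteSim.IsChannel N)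
    (ρ : BipartiteSim.Op (ah × bh)) (hρ : BipartiteSim.IsState ρ) :
    (BipartiteSim.feasibleValues N ρ).Nonempty ∧
      BddAbove (BipartiteSim.feasibleValues N ρ) ∧
      BipartiteSim.errPPT N ρ = 1 - (sSup (BipartiteSim.feasibleValues N ρ)) ^ 2 := by
  open BipartiteSim in
  -- With no output, trace preservation would fail on the nonzero input system: the Choi trace would
  -- vanish.
  have hout : Nonempty (a' × b') := by
    by_contra h
    rw [not_nonempty_iff] at h
    have h1 := trace_choi hN
    rw [Matrix.trace, Fintype.sum_empty] at h1
    exact Fintype.card_ne_zero (α := a × b) (by exact_mod_cast h1.symm)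
  obtain ⟨x, y⟩ := hout
  have : Nonempty a' := ⟨x⟩
  have : Nonempty b' := ⟨y⟩
  have hbdd : BddAbove (feasibleValues N ρ) := by
    refine ⟨1, fun lam hlam => ?_⟩
    obtain ⟨-, P, hP, Q, hQ, h⟩ := mem_feasibleValues_iff.1 hlam
    exact le_one_of_block hN (isChannel_simulate hρ hP.1) hQ h
  have hmem : ∀ P : Op ((a × ah) × (b × bh)) →ₗ[ℂ] Op (a' × b'), IsCPPTP P → ∀ f : ℝ, 0 ≤ f →
      f < √(channelFidelity N (simulate ρ P)) → f ∈ feasibleValues N ρ := by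
    intro P hP f hf0 hf
    exact mem_feasibleValues_iff.2
      ⟨hf0, P, hP, exists_block_le_realPart hN (isChannel_simulate hρ hP.1) hf⟩
  obtain ⟨P₀, hP₀⟩ := exists_isCPPTP (a := a × ah) (b := b × bh) (a' := a') (b' := b')
  have hne : (feasibleValues N ρ).Nonempty := by
    refine ⟨0, mem_feasibleValues_iff.2 ⟨le_rfl, P₀, hP₀, 0, ?_, ?_⟩⟩
    · rw [Matrix.conjTranspose_zero]
      exact fromBlocks_zero_posSemidef ((isChannel_iff N).1 hN).1
        ((isChannel_iff _).1 (isChannel_simulate hρ hP₀.1)).1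
    · have h : traceSnd (0 : Op ((a × b) × (a' × b'))) = 0 := by
        ext i j
        simp [traceSnd]
      rw [h, map_zero]
      simp
  refine ⟨hne, hbdd, ?_⟩
  have hs0 : 0 ≤ sSup (feasibleValues N ρ) :=
    Real.sSup_nonneg fun lam hlam => (mem_feasibleValues_iff.1 hlam).1
  have hle : ∀ P : Op ((a × ah) × (b × bh)) →ₗ[ℂ] Op (a' × b'), IsCPPTP P →
      1 - sSup (feasibleValues N ρ) ^ 2 ≤ 1 - channelFidelity N (simulate ρ P) := by
    intro P hP
    have h : √(channelFidelity N (simulate ρ P)) ≤ sSup (feasibleValues N ρ) := by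
      by_contra! hlt
      -- Only values strictly below the root fidelity are known to be feasible, hence the
      -- intermediate `f`.
      obtain ⟨f, hf1, hf2⟩ := exists_between hlt
      exact absurd (le_csSup hbdd (hmem P hP f (hs0.trans hf1.le) hf2)) hf1.not_ge
    have := (Real.sqrt_le_left hs0).1 h
    linarith
  have herr : ∀ P : Op ((a × ah) × (b × bh)) →ₗ[ℂ] Op (a' × b'), IsCPPTP P →
      errPPT N ρ ≤ 1 - channelFidelity N (simulate ρ P) := fun P hP =>
    csInf_le ⟨1 - sSup (feasibleValues N ρ) ^ 2, by rintro _ ⟨P, hP, rfl⟩; exact hle P hP⟩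
      ⟨P, hP, rfl⟩
  refine le_antisymm ?_ ?_
  · have h : ∀ lam ∈ feasibleValues N ρ, lam ≤ √(1 - errPPT N ρ) := by
      intro lam hlam
      obtain ⟨h0, P, hP, Q, hQ, h⟩ := mem_feasibleValues_iff.1 hlam
      refine Real.le_sqrt_of_sq_le ?_
      have h1 := sq_le_channelFidelity h0 hQ h
      have h2 := herr P hP
      linarith
    have h1 := csSup_le hne h
    have h2 : errPPT N ρ ≤ 1 := by
      refine (herr P₀ hP₀).trans ?_
      linarith [channelFidelity_nonneg N (simulate ρ P₀)]
    have h3 := (Real.le_sqrt hs0 (by linarith)).1 h1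
    linarith
  · refine le_csInf ⟨_, P₀, hP₀, rfl⟩ ?_
    rintro _ ⟨P, hP, rfl⟩
    exact hle P hP
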